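/- For a finite simple connected graph $G$ with vertex set $V$, let $d(u,v)$ denote the distance between vertices $u,v$ and let $\varepsilon(u)=\max_{v\in V}d(u,v)$ be the eccentricity of $u$. The anti-adjacency matrix $\mathcal A(G)=(\epsilon_{uv})_{u,v\in V}$ is given by $\epsilon_{uv}=d(u,v)$ if $d(u,v)=\min\{\varepsilon(u),\varepsilon(v)\}$ and $\epsilon_{uv}=0$ otherwise; its eigenvalues, counted with multiplicity, are the anti-adjacency eigenvalues of $G$. For a graph $H$ with vertex set $\{1,\dots,m\}$ and nonzero integers $s_1,\dots,s_m$, the mixed extension of $H$ of type $(s_1,\dots,s_m)$ is the graph obtained by replacing each vertex $i$ by a set $V_i$ of $|s_i|$ vertices that is a clique if $s_i>0$ and a coclique if $s_i<0$, where for $i\ne j$ a vertex of $V_i$ is adjacent to a vertex of $V_j$ if and only if $i$ and $j$ are adjacent in $H$. **Theorem.** Let $G$ be a finite simple connected graph. (i) The number of anti-adjacency eigenvalues of $G$ (counted with multiplicity) that are different from both $0$ and $-2$ is not equal to $1$. (ii) Exactly two anti-adjacency eigenvalues of $G$ (counted with multiplicity) are different from both $0$ and $-2$ if and only if $G$ is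 isomorphic to the mixed extension of $K_2$ of type $(-t_0,-t_1)$ for some integers $t_0,t_1\ge 1$; equivalently, if and only if $G$ is isomorphic to a complete bipartite graph $K_{t_0,t_1}$ with $t_0,t_1\ge 1$. -/

import Mathlib

namespace SimpleGraph

/-- The anti-adjacency (eccentricity) matrix of a graph: the entry at `(u, v)` is the distance
`d(u, v)` if `d(u, v) = min {ε(u), ε(v)}`, where `ε` is the eccentricity, and `0` otherwise. -/
noncomputable def antiAdjMatrix {V : Type*} (G : SimpleGraph V) : Matrix V V ℝ :=
  Matrix.of fun u v =>
    if (G.dist u v : ℕ∞) = min (G.eccent u) (G.eccent v) then (G.dist u v : ℝ) else 0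

/-- The anti-adjacency spectrum: the multiset of roots of the characteristic polynomial
`det (λ I - 𝒜(G))`, with algebraic multiplicities. The matrix is real symmetric,
so that all its eigenvalues are real. -/
noncomputable def antiAdjSpectrum {V : Type*} [Fintype V] [DecidableEq V]
    (G : SimpleGraph V) : Multiset ℝ :=
  G.antiAdjMatrix.charpoly.roots

/-- The number of anti-adjacency eigenvalues, counted with multiplicity, that are different
from both `0` and `-2`. -/
noncomputable def numAntiAdjEigenvaluesNe {V : Type*} [Fintype V] [DecidableEq V]
    (G : SimpleGraph V) : ℕ :=
  Multiset.card (G.antiAdjSpectrum.filter fun x => x ≠ 0 ∧ x ≠ -2)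

/-- The mixed extension of a graph `G` of type `t` (a tuple of nonzero integers): the vertex `i`
is replaced by a set `V_i` of `|t i|` vertices, which is a clique if `t i > 0` and a coclique if
`t i < 0`; vertices of `V_i` and `V_j` with `i ≠ j` are adjacent iff `i` and `j` are adjacent
in `G`. -/
def mixedExtension {ι : Type*} (G : SimpleGraph ι) (t : ι → ℤ) :
    SimpleGraph (Σ i, Fin (t i).natAbs) where
  Adj x y := (x.1 = y.1 ∧ x ≠ y ∧ 0 < t x.1) ∨ G.Adj x.1 y.1
  symm := ⟨by
    rintro x y (⟨h, hne, ht⟩ | h)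
    · exact Or.inl ⟨h.symm, hne.symm, h ▸ ht⟩
    · exact Or.inr h.symm⟩
  loopless := ⟨by
    rintro x (⟨-, hne, -⟩ | h)
    · exact hne rfl
    · exact G.loopless.irrefl _ h⟩

end SimpleGraph

/-! ### Counting eigenvalues of a real symmetric matrix by test vectors -/

namespace Matrix.IsHermitian

open Matrix Finset

variable {V : Type*} [Fintype V] [DecidableEq V] {A : Matrix V V ℝ}

/-! Let p, q, r count the eigenvalues of `A = 𝒜(G)` that are positive, in (-2, 0), and below -2; the
quantity studied is p + q + r. These are the numbers of positive eigenvalues of the forms A, -(A² +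
2A) and -(A + 2I), so vectors that are pairwise orthogonal and positive for one of these forms bound
the corresponding count from below. Everything reduces to two facts: on at least two vertices p + q
+ r ≤ 2 forces G to be complete bipartite, and complete bipartite graphs have p + q + r = 2. In
particular the value 1 never occurs.

If G has no universal vertex, adjacent vertices have entry 0. With p ≤ 1, zero entries would form a
transitive relation, and connectedness would give A = 0; so p = 2 and q = r = 0. Then r = 0 forces
diameter at most 2, so that A is twice the adjacency matrix of the complement, and makes
non-adjacency transitive. A triangle would now give three mutually unlinked edges of the complement,
hence p ≥ 3.

If G has a universal vertex, the diameter is at most 2, universal vertices give entries 1, and all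
other entries are 0 or 2. Three universal vertices give q ≥ 2. For two, or for one with an edge
avoiding it, explicit vectors for -(A² + 2A) together with the bounds on p and r give a total of at
least 3. What remains is a star.

Conversely, for a complete bipartite graph the entries of A + 2I depend only on the two sides, so
its rank is at most 2, while test vectors supply two eigenvalues. -/

lemma exists_orthogonal_diagonalization (hA : A.IsHermitian) :
    ∃ U : Matrix V V ℝ, U * Uᵀ = 1 ∧
      A = U * diagonal hA.eigenvalues * Uᵀ := by
  refine ⟨hA.eigenvectorUnitary, ?_, ?_⟩
  · simpa [star_eq_conjTranspose] using
      (Unitary.mul_star_self_of_mem hA.eigenvectorUnitary.2)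
  · have := hA.spectral_theorem
    rw [Unitary.conjStarAlgAut_apply] at this
    simpa [star_eq_conjTranspose, Function.comp_def] using this

/-- If the form of `U f(Λ) Uᵀ` is positive on `j` vectors that are orthogonal for it, then at least
`j` of the values `f(Λ)` are positive. -/
lemma le_card_of_orthogonal {U F : Matrix V V ℝ} {f : V → ℝ}
    (hF : F = U * diagonal f * Uᵀ) {j : ℕ} (w : Fin j → V → ℝ)
    (horth : ∀ a b, a ≠ b → w a ⬝ᵥ F *ᵥ w b = 0) (hpos : ∀ a, 0 < w a ⬝ᵥ F *ᵥ w a) :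
    j ≤ #{i | 0 < f i} := by
  by_contra! hlt
  let W : Matrix V (Fin j) ℝ := of fun v a => w a v
  -- With fewer than j positive values, some nonzero combination of the `w a` has no component along
  -- the eigenvectors where `f` is positive. The form is then nonpositive there, yet positive by
  -- orthogonality.
  let L : (Fin j → ℝ) →ₗ[ℝ] ({i // 0 < f i} → ℝ) :=
    (LinearMap.funLeft ℝ ℝ Subtype.val).comp (Uᵀ * W).mulVecLin
  have hker : LinearMap.ker L ≠ ⊥ := by
    apply LinearMap.ker_ne_bot_of_finrank_lt
    simpa [Fintype.card_subtype] using hlt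
  obtain ⟨c, hc, hc0⟩ := (Submodule.ne_bot_iff _).1 hker
  have hL : ∀ i, 0 < f i → (Uᵀ *ᵥ (W *ᵥ c)) i = 0 := by
    intro i hi
    have := congrFun (LinearMap.mem_ker.1 hc) ⟨i, hi⟩
    rw [mulVec_mulVec]
    exact this
  have h1 : (W *ᵥ c) ⬝ᵥ F *ᵥ (W *ᵥ c) = ∑ i, f i * (Uᵀ *ᵥ (W *ᵥ c)) i ^ 2 := by
    rw [hF, mul_assoc, ← mulVec_mulVec, dotProduct_mulVec, ← mulVec_transpose, ← mulVec_mulVec]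
    simp only [dotProduct, mulVec_diagonal]
    exact Finset.sum_congr rfl fun i _ => by ring
  have h2 : (W *ᵥ c) ⬝ᵥ F *ᵥ (W *ᵥ c) = ∑ a, c a ^ 2 * (w a ⬝ᵥ F *ᵥ w a) := by
    have hW : W *ᵥ c = ∑ a, c a • w a := by
      ext v
      simp [W, mulVec, dotProduct, mul_comm]
    rw [hW, mulVec_sum, sum_dotProduct]
    refine Finset.sum_congr rfl fun a _ => ?_
    rw [dotProduct_sum, Finset.sum_eq_single a]
    · simp [mulVec_smul, pow_two, mul_assoc]
    · intro b _ hb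
      simp [mulVec_smul, horth a b hb.symm]
    · simp
  have h3 : 0 < ∑ a, c a ^ 2 * (w a ⬝ᵥ F *ᵥ w a) := by
    obtain ⟨a, ha⟩ := Function.ne_iff.1 hc0
    refine Finset.sum_pos' (fun a _ => mul_nonneg (sq_nonneg _) (hpos a).le) ⟨a, mem_univ _, ?_⟩
    exact mul_pos (by have : c a ≠ 0 := ha; positivity) (hpos a)
  have h4 : ∑ i, f i * (Uᵀ *ᵥ (W *ᵥ c)) i ^ 2 ≤ 0 := by
    refine Finset.sum_nonpos fun i _ => ?_
    by_cases hi : 0 < f i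
    · simp [hL i hi]
    · exact mul_nonpos_of_nonpos_of_nonneg (not_lt.1 hi) (sq_nonneg _)
  linarith

lemma le_card_pos (hA : A.IsHermitian) {j : ℕ} (w : Fin j → V → ℝ)
    (horth : ∀ a b, a ≠ b → w a ⬝ᵥ A *ᵥ w b = 0) (hpos : ∀ a, 0 < w a ⬝ᵥ A *ᵥ w a) :
    j ≤ #{i | 0 < hA.eigenvalues i} := by
  obtain ⟨U, -, hU⟩ := hA.exists_orthogonal_diagonalization
  exact le_card_of_orthogonal hU w horth hpos

/-- The positivity count for the form -A - 2I. -/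
lemma le_card_lt_neg_two (hA : A.IsHermitian) {j : ℕ} (w : Fin j → V → ℝ)
    (horth : ∀ a b, a ≠ b → w a ⬝ᵥ A *ᵥ w b = -2 * (w a ⬝ᵥ w b))
    (hneg : ∀ a, w a ⬝ᵥ A *ᵥ w a < -2 * (w a ⬝ᵥ w a)) :
    j ≤ #{i | hA.eigenvalues i < -2} := by
  obtain ⟨U, hU1, hU⟩ := hA.exists_orthogonal_diagonalization
  have hF : -A - (2 : ℝ) • 1 =
      U * diagonal (fun i => -hA.eigenvalues i - 2) * Uᵀ := by
    have : diagonal (fun i => -hA.eigenvalues i - 2) =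
        -diagonal hA.eigenvalues - (2 : ℝ) • (1 : Matrix V V ℝ) := by
      ext a b
      by_cases h : a = b <;> simp [h]
    rw [this, mul_sub, sub_mul, mul_neg, neg_mul, ← hU, mul_smul_comm, smul_mul_assoc, mul_one,
      hU1]
  have := le_card_of_orthogonal hF w (fun a b hab => ?_) (fun a => ?_)
  · simpa [lt_neg] using this
  · simp [sub_mulVec, neg_mulVec, smul_mulVec, dotProduct_sub, horth a b hab]
  · have := hneg a
    simp [sub_mulVec, neg_mulVec, smul_mulVec, dotProduct_sub]
    linarith

/-- The positivity count for -A² - 2A: the value -λ² - 2λ is positive exactly when -2 < λ < 0. -/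
lemma le_card_Ioo (hA : A.IsHermitian) {j : ℕ} (w : Fin j → V → ℝ)
    (horth : ∀ a b, a ≠ b → (A *ᵥ w a) ⬝ᵥ (A *ᵥ w b) + 2 * (w a ⬝ᵥ A *ᵥ w b) = 0)
    (hneg : ∀ a, (A *ᵥ w a) ⬝ᵥ (A *ᵥ w a) + 2 * (w a ⬝ᵥ A *ᵥ w a) < 0) :
    j ≤ #{i | -2 < hA.eigenvalues i ∧ hA.eigenvalues i < 0} := by
  obtain ⟨U, hU1, hU⟩ := hA.exists_orthogonal_diagonalization
  have hU2 : Uᵀ * U = 1 := mul_eq_one_comm.1 hU1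
  have hF : -(A * A) - (2 : ℝ) • A =
      U * diagonal (fun i => -(hA.eigenvalues i * hA.eigenvalues i) - 2 * hA.eigenvalues i) *
        Uᵀ := by
    have : diagonal (fun i => -(hA.eigenvalues i * hA.eigenvalues i) - 2 * hA.eigenvalues i) =
        -(diagonal hA.eigenvalues * diagonal hA.eigenvalues)
          - (2 : ℝ) • diagonal hA.eigenvalues := by
      ext a b
      by_cases h : a = b <;> simp [h]
    have h2 : A * A = U * (diagonal hA.eigenvalues * diagonal hA.eigenvalues) * Uᵀ := by
      calc A * A = (U * diagonal hA.eigenvalues * Uᵀ) * (U * diagonal hA.eigenvalues * Uᵀ) := by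
            rw [← hU]
        _ = U * diagonal hA.eigenvalues * (Uᵀ * U) * diagonal hA.eigenvalues * Uᵀ := by
            simp only [mul_assoc]
        _ = _ := by rw [hU2]; simp only [mul_assoc, one_mul]
    rw [this, mul_sub, sub_mul, mul_neg, neg_mul, ← h2, mul_smul_comm, smul_mul_assoc, ← hU]
  have hT : Aᵀ = A := by simpa using hA.eq
  have hAA : ∀ x y : V → ℝ, x ⬝ᵥ (A * A) *ᵥ y = (A *ᵥ x) ⬝ᵥ (A *ᵥ y) := by
    intro x y
    rw [← mulVec_mulVec, dotProduct_mulVec, ← mulVec_transpose, hT]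
  have := le_card_of_orthogonal hF w (fun a b hab => ?_) (fun a => ?_)
  · refine this.trans (card_le_card fun i hi => ?_)
    simp only [mem_filter, mem_univ, true_and] at hi ⊢
    constructor <;> nlinarith
  · have := horth a b hab
    simp only [sub_mulVec, neg_mulVec, smul_mulVec, dotProduct_sub, dotProduct_neg, hAA,
      dotProduct_smul, smul_eq_mul]
    linarith
  · have := hneg a
    simp only [sub_mulVec, neg_mulVec, smul_mulVec, dotProduct_sub, dotProduct_neg, hAA,
      dotProduct_smul, smul_eq_mul]
    linarith

lemma card_filter_roots_charpoly (hA : A.IsHermitian) :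
    Multiset.card (A.charpoly.roots.filter fun x => x ≠ 0 ∧ x ≠ -2) =
      #{i | 0 < hA.eigenvalues i} + #{i | -2 < hA.eigenvalues i ∧ hA.eigenvalues i < 0} +
        #{i | hA.eigenvalues i < -2} := by
  have h : A.charpoly.roots = (univ : Finset V).val.map hA.eigenvalues := by
    simpa [Function.comp_def] using hA.roots_charpoly_eq_eigenvalues
  rw [h, Multiset.filter_map, Multiset.card_map]
  change #{i | hA.eigenvalues i ≠ 0 ∧ hA.eigenvalues i ≠ -2} = _
  rw [← card_union_of_disjoint, ← card_union_of_disjoint]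
  · congr 1
    ext i
    simp only [mem_filter, mem_univ, true_and, mem_union]
    constructor
    · rintro ⟨h0, h2⟩
      rcases lt_or_gt_of_ne h0 with h | h
      · rcases lt_or_gt_of_ne h2 with h' | h'
        · exact Or.inr h'
        · exact Or.inl (Or.inr ⟨h', h⟩)
      · exact Or.inl (Or.inl h)
    · rintro ((h | ⟨h, h'⟩) | h) <;> constructor <;> intro h'' <;> linarith
  · rw [disjoint_left]
    intro i
    simp only [mem_filter, mem_univ, true_and, mem_union, not_lt]
    rintro (h | ⟨h, h'⟩) <;> linarith
  · rw [disjoint_left]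
    intro i
    simp only [mem_filter, mem_univ, true_and, not_and, not_lt]
    intros; linarith

/-- A real symmetric matrix has at most `rank (A + 2)` eigenvalues different from `-2`. -/
lemma card_filter_roots_charpoly_le_rank (hA : A.IsHermitian) :
    Multiset.card (A.charpoly.roots.filter fun x => x ≠ 0 ∧ x ≠ -2) ≤ (A + (2 : ℝ) • 1).rank := by
  obtain ⟨U, hU1, hU⟩ := hA.exists_orthogonal_diagonalization
  have hU2 : Uᵀ * U = 1 := mul_eq_one_comm.1 hU1
  have h : A.charpoly.roots = (univ : Finset V).val.map hA.eigenvalues := by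
    simpa [Function.comp_def] using hA.roots_charpoly_eq_eigenvalues
  have hF : diagonal (fun i => hA.eigenvalues i + 2) = Uᵀ * (A + (2 : ℝ) • 1) * U := by
    have : diagonal (fun i => hA.eigenvalues i + 2) =
        diagonal hA.eigenvalues + (2 : ℝ) • (1 : Matrix V V ℝ) := by
      ext a b
      by_cases h : a = b <;> simp [h]
    have h2 : Uᵀ * A * U = diagonal hA.eigenvalues := by
      calc Uᵀ * A * U = Uᵀ * (U * diagonal hA.eigenvalues * Uᵀ) * U := by rw [← hU]
        _ = (Uᵀ * U) * diagonal hA.eigenvalues * (Uᵀ * U) := by simp only [mul_assoc]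
        _ = _ := by rw [hU2]; simp
    rw [this, mul_add, add_mul, h2, mul_smul_comm, smul_mul_assoc, mul_one, hU2]
  rw [h, Multiset.filter_map, Multiset.card_map]
  change #{i | hA.eigenvalues i ≠ 0 ∧ hA.eigenvalues i ≠ -2} ≤ _
  calc _ ≤ #{i | hA.eigenvalues i + 2 ≠ 0} := by
        refine card_le_card fun i hi => ?_
        simp only [mem_filter, mem_univ, true_and] at hi ⊢
        exact fun h => hi.2 (by linarith)
    _ = (diagonal fun i => hA.eigenvalues i + 2).rank := by
        rw [rank_diagonal, Fintype.card_subtype]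
    _ ≤ _ := by
        rw [hF]
        exact (rank_mul_le_left _ _).trans (rank_mul_le_right _ _)

end Matrix.IsHermitian

/-! ### Local patterns of entries that force eigenvalues -/

namespace Matrix.IsHermitian

open Matrix Finset

variable {V : Type*} [Fintype V] [DecidableEq V] {A : Matrix V V ℝ}

lemma one_le_card_pos (hA : A.IsHermitian) (h0 : ∀ v, A v v = 0) {a b : V} (hab : 0 < A a b) :
    1 ≤ #{i | 0 < hA.eigenvalues i} := by
  have hs : ∀ u v, A u v = A v u := fun u v => by simpa using hA.apply v u
  refine hA.le_card_pos ![Pi.single a 1 + Pi.single b 1] ?_ ?_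
  · intro i j hij
    exact absurd (Subsingleton.elim i j) hij
  · intro i
    fin_cases i
    simp [mulVec_add, add_dotProduct, h0, hs b a, hab]

/-- The support graph of a matrix with only one positive eigenvalue contains no induced
disjoint union of an edge and a non-isolated vertex. -/
lemma two_le_card_pos (hA : A.IsHermitian) (h0 : ∀ v, A v v = 0) {a b c d : V}
    (hab : 0 < A a b) (hcd : 0 < A c d) (hac : A a c = 0) (had : A a d = 0) :
    2 ≤ #{i | 0 < hA.eigenvalues i} := by
  have hs : ∀ u v, A u v = A v u := fun u v => by simpa using hA.apply v u
  have hca : A c a = 0 := by rw [hs, hac]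
  have hda : A d a = 0 := by rw [hs, had]
  -- The multiple of e_a makes the second vector orthogonal to the first; it leaves the value 2 A c
  -- d unchanged, because e_a is orthogonal for A to itself, e_c and e_d.
  refine hA.le_card_pos ![Pi.single a 1 + Pi.single b 1,
    Pi.single c 1 + Pi.single d 1 - ((A b c + A b d) / A a b) • Pi.single a 1] ?_ ?_
  · intro i j hij
    fin_cases i <;> fin_cases j <;> first | exact absurd rfl hij | skip
    · simp [mulVec_add, mulVec_sub, add_dotProduct, mulVec_smul, h0, hs b a, hac, had]
      field_simp
      ring
    · simp [mulVec_add, sub_dotProduct, add_dotProduct, h0, hca, hda, hs c b, hs d b]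
      field_simp
      ring
  · intro i
    fin_cases i
    · simp [mulVec_add, add_dotProduct, h0, hs b a, hab]
    · simp [mulVec_add, mulVec_sub, add_dotProduct, sub_dotProduct, mulVec_smul, h0, hs d c, hcd,
        hac, had, hca, hda]

lemma three_le_card_pos (hA : A.IsHermitian) (h0 : ∀ v, A v v = 0) (x y : Fin 3 → V)
    (hxy : ∀ i, 0 < A (x i) (y i)) (hxx : ∀ i j, i ≠ j → A (x i) (x j) = 0)
    (hyy : ∀ i j, i ≠ j → A (y i) (y j) = 0) (hxy' : ∀ i j, i ≠ j → A (x i) (y j) = 0) :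
    3 ≤ #{i | 0 < hA.eigenvalues i} := by
  have hs : ∀ u v, A u v = A v u := fun u v => by simpa using hA.apply v u
  refine hA.le_card_pos (fun i => Pi.single (x i) 1 + Pi.single (y i) 1) ?_ ?_
  · intro i j hij
    simp [mulVec_add, add_dotProduct, hxx i j hij, hyy i j hij, hxy' i j hij,
      hs (y i) (x j), hxy' j i hij.symm]
  · intro i
    simp [mulVec_add, add_dotProduct, h0, hs (y i) (x i), hxy i]

lemma one_le_card_lt_neg_two (hA : A.IsHermitian) (h0 : ∀ v, A v v = 0) {u v : V}
    (huv : 2 < A u v) : 1 ≤ #{i | hA.eigenvalues i < -2} := by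
  have hs : ∀ u v, A u v = A v u := fun u v => by simpa using hA.apply v u
  have hne : u ≠ v := by
    rintro rfl
    linarith [h0 u]
  refine hA.le_card_lt_neg_two ![Pi.single u 1 - Pi.single v 1] ?_ ?_
  · intro i j hij
    exact absurd (Subsingleton.elim i j) hij
  · intro i
    fin_cases i
    simp [mulVec_sub, sub_dotProduct, h0, hs v u, hne, hne.symm]
    linarith

/-- On e_x - e_y + e_z the form A takes the value -8, below -2 · 3. -/
lemma one_le_card_lt_neg_two_of_path (hA : A.IsHermitian) (h0 : ∀ v, A v v = 0) {x y z : V}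
    (hyx : A y x = 2) (hyz : A y z = 2) (hxz : A x z = 0) (hne : x ≠ z) :
    1 ≤ #{i | hA.eigenvalues i < -2} := by
  have hs : ∀ u v, A u v = A v u := fun u v => by simpa using hA.apply v u
  have h1 : x ≠ y := by
    rintro rfl
    simp [h0] at hyx
  have h2 : z ≠ y := by
    rintro rfl
    simp [h0] at hyz
  refine hA.le_card_lt_neg_two ![Pi.single x 1 - Pi.single y 1 + Pi.single z 1] ?_ ?_
  · intro i j hij
    exact absurd (Subsingleton.elim i j) hij
  · intro i
    fin_cases i
    simp [mulVec_sub, mulVec_add, sub_dotProduct, add_dotProduct, h0, hs x y, hs z y, hs z x,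
      hyx, hyz, hxz, h1, h1.symm, h2, h2.symm, hne, hne.symm]
    norm_num

/-- If only one eigenvalue is positive, having entry `0` is a transitive relation. -/
lemma apply_eq_zero_trans (hA : A.IsHermitian) (h0 : ∀ v, A v v = 0) (hnn : ∀ u v, 0 ≤ A u v)
    (hrow : ∀ u, ∃ v, 0 < A u v) (hp : #{i | 0 < hA.eigenvalues i} ≤ 1) {a c d : V}
    (hac : A a c = 0) (had : A a d = 0) : A c d = 0 := by
  by_contra hcd
  obtain ⟨b, hb⟩ := hrow a
  have := hA.two_le_card_pos h0 hb ((hnn c d).lt_of_ne' hcd) hac had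
  omega

end Matrix.IsHermitian

/-! ### Entries of the anti-adjacency matrix -/

namespace SimpleGraph

open Matrix Finset

variable {V : Type*} {G : SimpleGraph V}

open Classical in
-- A distance never exceeds either eccentricity, so it equals their minimum as soon as it reaches
-- one of them.
lemma antiAdjMatrix_apply (hG : G.Connected) (u v : V) :
    G.antiAdjMatrix u v = if (∀ w, G.dist u w ≤ G.dist u v) ∨ (∀ w, G.dist v w ≤ G.dist u v)
      then (G.dist u v : ℝ) else 0 := by
  have hd : ∀ x y, G.edist x y = (G.dist x y : ℕ∞) :=
    fun x y => ((hG.preconnected x y).coe_dist_eq_edist).symm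
  have hle : ∀ x y, G.eccent x ≤ (G.dist x y : ℕ∞) ↔ ∀ w, G.dist x w ≤ G.dist x y := by
    intro x y
    simp [eccent_le_iff, hd]
  have h1 : (G.dist u v : ℕ∞) ≤ G.eccent u := hd u v ▸ edist_le_eccent
  have h2 : (G.dist u v : ℕ∞) ≤ G.eccent v := by
    rw [dist_comm, ← hd v u]
    exact edist_le_eccent
  have : (G.dist u v : ℕ∞) = min (G.eccent u) (G.eccent v) ↔
      (∀ w, G.dist u w ≤ G.dist u v) ∨ (∀ w, G.dist v w ≤ G.dist u v) := by
    have hvu := hle v u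
    rw [G.dist_comm (u := v) (v := u)] at hvu
    rw [← hle, ← hvu, ← min_le_iff]
    exact ⟨fun h => h.ge, fun h => le_antisymm (le_min h1 h2) h⟩
  simp only [antiAdjMatrix, of_apply, this]

lemma antiAdjMatrix_isHermitian : G.antiAdjMatrix.IsHermitian := by
  ext u v
  simp [antiAdjMatrix, dist_comm, min_comm]

lemma antiAdjMatrix_comm (u v : V) : G.antiAdjMatrix u v = G.antiAdjMatrix v u := by
  simpa using G.antiAdjMatrix_isHermitian.apply v u

lemma antiAdjMatrix_self (v : V) : G.antiAdjMatrix v v = 0 := by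
  simp [antiAdjMatrix]

lemma antiAdjMatrix_nonneg (u v : V) : 0 ≤ G.antiAdjMatrix u v := by
  simp only [antiAdjMatrix, of_apply]
  split_ifs <;> positivity

lemma exists_antiAdjMatrix_eq_dist [Finite V] (hG : G.Connected) (u : V) :
    ∃ v, (∀ w, G.dist u w ≤ G.dist u v) ∧ G.antiAdjMatrix u v = G.dist u v := by
  have : Nonempty V := ⟨u⟩
  obtain ⟨v, hv⟩ := Finite.exists_max fun v => G.dist u v
  exact ⟨v, hv, by rw [antiAdjMatrix_apply hG, if_pos (Or.inl hv)]⟩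

lemma exists_antiAdjMatrix_pos [Finite V] [Nontrivial V] (hG : G.Connected) (u : V) :
    ∃ v, 0 < G.antiAdjMatrix u v := by
  obtain ⟨v, hv, h⟩ := exists_antiAdjMatrix_eq_dist hG u
  obtain ⟨w, hw⟩ := exists_ne u
  refine ⟨v, ?_⟩
  rw [h]
  exact_mod_cast (hG.pos_dist_of_ne hw.symm).trans_le (hv w)

lemma antiAdjMatrix_of_isUniversal (hG : G.Connected) {u v : V} (hu : G.IsUniversal u)
    (hne : u ≠ v) : G.antiAdjMatrix u v = 1 := by
  have h1 : G.dist u v = 1 := dist_eq_one_iff_adj.2 (hu hne)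
  rw [antiAdjMatrix_apply hG, h1, if_pos]
  · simp
  · refine Or.inl fun w => ?_
    by_cases hw : u = w
    · simp [hw]
    · exact (dist_eq_one_iff_adj.2 (hu hw)).le

lemma isUniversal_of_dist_le_one (hG : G.Connected) {u : V} (h : ∀ w, G.dist u w ≤ 1) :
    G.IsUniversal u := fun w hw =>
  dist_eq_one_iff_adj.1 (le_antisymm (h w) (hG.pos_dist_of_ne hw))

lemma antiAdjMatrix_of_adj (hG : G.Connected) {u v : V} (hu : ¬ G.IsUniversal u)
    (hv : ¬ G.IsUniversal v) (h : G.Adj u v) : G.antiAdjMatrix u v = 0 := by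
  rw [antiAdjMatrix_apply hG, dist_eq_one_iff_adj.2 h, if_neg]
  rintro (h | h)
  · exact hu (isUniversal_of_dist_le_one hG h)
  · exact hv (isUniversal_of_dist_le_one hG h)

lemma antiAdjMatrix_of_not_adj (hG : G.Connected) (hd : ∀ u v, G.dist u v ≤ 2) {u v : V}
    (hne : u ≠ v) (h : ¬ G.Adj u v) : G.antiAdjMatrix u v = 2 := by
  have h2 : G.dist u v = 2 := by
    have h1 := hG.pos_dist_of_ne hne
    have h3 : G.dist u v ≠ 1 := fun h1 => h (dist_eq_one_iff_adj.1 h1)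
    have := hd u v
    omega
  rw [antiAdjMatrix_apply hG, h2, if_pos (Or.inl (hd u))]
  simp

lemma dist_le_two_of_isUniversal {d : V} (h : G.IsUniversal d) (u v : V) :
    G.dist u v ≤ 2 := by
  by_cases hu : d = u
  · subst hu
    by_cases hv : d = v
    · simp [hv]
    · rw [dist_eq_one_iff_adj.2 (h hv)]
      norm_num
  · by_cases hv : d = v
    · subst hv
      rw [dist_eq_one_iff_adj.2 (h hu).symm]
      norm_num
    · exact dist_le (Walk.cons (h hu).symm (Walk.cons (h hv) Walk.nil))

/-- The complete bipartite graphs with two nonempty sides, presented by a `2`-colouring. -/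
def IsCompleteBipartite (G : SimpleGraph V) : Prop :=
  ∃ c : V → Fin 2, Function.Surjective c ∧ ∀ u v, G.Adj u v ↔ c u ≠ c v

/-- Transitive non-adjacency makes G complete multipartite, and without triangles there are only two
parts: the neighbours of `u` and the rest. -/
lemma isCompleteBipartite_of_adj {u v : V} (huv : G.Adj u v)
    (htrans : ∀ x y z, ¬ G.Adj x y → ¬ G.Adj y z → ¬ G.Adj x z)
    (htri : ∀ x y z, G.Adj x y → G.Adj y z → ¬ G.Adj x z) : G.IsCompleteBipartite := by
  classical
  refine ⟨fun x => if G.Adj u x then 1 else 0, ?_, ?_⟩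
  · intro i
    fin_cases i
    · exact ⟨u, by simp⟩
    · exact ⟨v, by simp [huv]⟩
  · intro x y
    by_cases hx : G.Adj u x <;> by_cases hy : G.Adj u y <;> simp only [hx, hy, if_true, if_false]
    · simpa using htri x u y hx.symm hy
    · simp only [ne_eq, one_ne_zero, not_false_eq_true, iff_true]
      by_contra h
      exact htrans u y x hy (fun h' => h h'.symm) hx
    · simp only [ne_eq, zero_ne_one, not_false_eq_true, iff_true]
      by_contra h
      exact htrans u x y hx h hy
    · simpa using htrans x u y (fun h => hx h.symm) hy

end SimpleGraph

/-! ### Graphs without universal vertex -/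

namespace SimpleGraph

open Matrix Finset

variable {V : Type*} [Fintype V] [DecidableEq V] {G : SimpleGraph V}

lemma numAntiAdjEigenvaluesNe_eq (G : SimpleGraph V) : G.numAntiAdjEigenvaluesNe =
    #{i | 0 < G.antiAdjMatrix_isHermitian.eigenvalues i} +
      #{i | -2 < G.antiAdjMatrix_isHermitian.eigenvalues i ∧
        G.antiAdjMatrix_isHermitian.eigenvalues i < 0} +
      #{i | G.antiAdjMatrix_isHermitian.eigenvalues i < -2} :=
  G.antiAdjMatrix_isHermitian.card_filter_roots_charpoly

lemma isCompleteBipartite_of_forall_not_isUniversal (hG : G.Connected)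
    (hn : G.numAntiAdjEigenvaluesNe ≤ 2) (hu : ∀ u, ¬ G.IsUniversal u) :
    G.IsCompleteBipartite := by
  have hA := G.antiAdjMatrix_isHermitian
  have h0 := G.antiAdjMatrix_self
  have hnn := G.antiAdjMatrix_nonneg
  have hs := G.antiAdjMatrix_comm
  have hex : ∀ u, ∃ w, u ≠ w ∧ ¬ G.Adj u w := by
    intro u
    have := hu u
    unfold IsUniversal at this
    push Not at this
    exact this
  obtain ⟨u₀⟩ := hG.nonempty
  obtain ⟨w₀, hw₀, -⟩ := hex u₀
  have : Nontrivial V := ⟨u₀, w₀, hw₀⟩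
  have hrow := exists_antiAdjMatrix_pos hG
  have hadj : ∀ {u v}, G.Adj u v → G.antiAdjMatrix u v = 0 :=
    fun h => antiAdjMatrix_of_adj hG (hu _) (hu _) h
  rw [numAntiAdjEigenvaluesNe_eq] at hn
  have hp : 2 ≤ #{i | 0 < hA.eigenvalues i} := by
    by_contra! hp
    -- Edges have entry 0, and for p ≤ 1 zero entries are transitive, so they spread along walks.
    have hall : ∀ u v, G.antiAdjMatrix u v = 0 := by
      intro u v
      obtain ⟨W⟩ := hG.preconnected u v
      induction W with
      | nil => exact h0 _
      | cons h W ih =>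
        exact hA.apply_eq_zero_trans h0 hnn hrow (by omega) (by rw [hs, hadj h]) ih
    obtain ⟨v, hv⟩ := hrow u₀
    exact hv.ne' (hall _ _)
  have hr : #{i | hA.eigenvalues i < -2} = 0 := by omega
  have hp2 : #{i | 0 < hA.eigenvalues i} < 3 := by omega
  have hd : ∀ u v, G.dist u v ≤ 2 := by
    intro u v
    by_contra! h
    obtain ⟨w, hw, hw'⟩ := exists_antiAdjMatrix_eq_dist hG u
    have h3 : 2 < G.antiAdjMatrix u w := by
      rw [hw']
      exact_mod_cast h.trans_le (hw v)
    have := hA.one_le_card_lt_neg_two h0 h3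
    omega
  have hnadj : ∀ {u v}, u ≠ v → ¬ G.Adj u v → G.antiAdjMatrix u v = 2 :=
    fun hne h => antiAdjMatrix_of_not_adj hG hd hne h
  have htrans : ∀ x y z, ¬ G.Adj x y → ¬ G.Adj y z → ¬ G.Adj x z := by
    intro x y z hxy hyz hxz
    by_cases h1 : x = y
    · exact hyz (h1 ▸ hxz)
    by_cases h2 : y = z
    · exact hxy (h2 ▸ hxz)
    have := hA.one_le_card_lt_neg_two_of_path h0 (by rw [hs, hnadj h1 hxy]) (hnadj h2 hyz)
      (hadj hxz) hxz.ne
    omega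
  obtain ⟨v₀, hv₀⟩ := hG.preconnected.exists_adj_of_nontrivial u₀
  refine isCompleteBipartite_of_adj hv₀ htrans ?_
  intro x y z hxy hyz hxz
  choose f hf hf' using hex
  have hsymm : ∀ {x y}, ¬ G.Adj x y → ¬ G.Adj y x := fun h h' => h h'.symm
  have key : ∀ i j : Fin 3, i ≠ j → G.Adj (![x, y, z] i) (![x, y, z] j) := by
    intro i j hij
    fin_cases i <;> fin_cases j <;> first | exact absurd rfl hij | skip
    · exact hxy
    · exact hxz
    · exact hxy.symm
    · exact hyz
    · exact hxz.symm
    · exact hyz.symm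
  -- Each triangle vertex is paired with a non-neighbour, which lies in the same part; different
  -- parts are joined completely, so entries between different pairs vanish.
  refine absurd (hA.three_le_card_pos h0 ![x, y, z] (fun i => f (![x, y, z] i)) ?_ ?_ ?_ ?_)
    (not_le.2 hp2)
  · intro i
    rw [hnadj (hf _) (hf' _)]
    norm_num
  · exact fun i j hij => hadj (key i j hij)
  · intro i j hij
    refine hadj (by_contra fun h => ?_)
    exact htrans _ _ _ (htrans _ _ _ (hf' _) h) (hsymm (hf' _)) (key i j hij)
  · intro i j hij
    refine hadj (by_contra fun h => ?_)
    exact htrans _ _ _ h (hsymm (hf' _)) (key i j hij)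

end SimpleGraph

/-! ### Test vectors in the presence of universal vertices -/

namespace Matrix.IsHermitian

open Matrix Finset

variable {V : Type*} [Fintype V] [DecidableEq V] {A : Matrix V V ℝ}

/-- On eigenvectors for -1 the form A² + 2A is minus the squared norm. -/
lemma le_card_Ioo_of_mulVec_eq_neg (hA : A.IsHermitian) {j : ℕ} (w : Fin j → V → ℝ)
    (hw : ∀ a, A *ᵥ w a = -w a) (horth : ∀ a b, a ≠ b → w a ⬝ᵥ w b = 0) (hne : ∀ a, w a ≠ 0) :
    j ≤ #{i | -2 < hA.eigenvalues i ∧ hA.eigenvalues i < 0} := by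
  refine hA.le_card_Ioo w (fun a b hab => ?_) (fun a => ?_)
  · simp [hw, horth a b hab]
  · have : 0 < w a ⬝ᵥ w a := by
      have h := dotProduct_self_star_pos_iff.2 (hne a)
      simpa using h
    simp only [hw, dotProduct_neg, neg_dotProduct, neg_neg]
    linarith

/-- The image of `a 1_D - 1_T`, when all off-diagonal entries in the rows of `D` are `1` and every
other row has, on the set `T`, a single entry `0` and entries `2` elsewhere. -/
lemma mulVec_sub_indicator (D T : Finset V)
    (hD : ∀ u ∈ D, ∀ v, A u v = if u = v then 0 else 1) (hD' : ∀ u ∈ D, ∀ v ∉ D, A v u = 1)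
    (hDT : Disjoint D T) (hT : ∀ v ∉ D, ∃ t ∈ T, ∀ w ∈ T, A v w = if w = t then 0 else 2)
    (a : ℝ) :
    A *ᵥ (fun v => (if v ∈ D then a else 0) - if v ∈ T then 1 else 0) =
      fun v => if v ∈ D then a * (#D - 1) - #T else a * #D - 2 * (#T - 1) := by
  ext v
  have h : (A *ᵥ (fun v => (if v ∈ D then a else 0) - if v ∈ T then 1 else 0)) v =
      a * ∑ w ∈ D, A v w - ∑ w ∈ T, A v w := by
    simp only [mulVec, dotProduct, mul_sub, sum_sub_distrib, mul_ite, mul_zero, mul_one,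
      Finset.sum_ite_mem, univ_inter, mul_sum]
    simp only [mul_comm]
  rw [h]
  split_ifs with hv
  · have h1 : ∑ w ∈ D, A v w = #D - 1 := by
      rw [← Finset.add_sum_erase D _ hv, hD v hv, if_pos rfl, zero_add,
        Finset.sum_congr rfl fun w hw => by rw [hD v hv, if_neg (ne_of_mem_erase hw).symm]]
      simp [card_erase_of_mem hv, Nat.cast_sub (card_pos.2 ⟨v, hv⟩)]
    have h2 : ∑ w ∈ T, A v w = #T := by
      rw [Finset.sum_congr rfl fun w hw => (hD v hv w).trans
        (if_neg (fun h : v = w => disjoint_left.1 hDT hv (h ▸ hw)))]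
      simp
    rw [h1, h2]
  · obtain ⟨t, ht, hT⟩ := hT v hv
    have h1 : ∑ w ∈ D, A v w = #D := by
      rw [Finset.sum_congr rfl fun w hw => hD' w hw v hv]
      simp
    have h2 : ∑ w ∈ T, A v w = 2 * (#T - 1) := by
      rw [← Finset.add_sum_erase T _ ht, hT t ht, if_pos rfl, zero_add,
        Finset.sum_congr rfl fun w hw => by
          rw [hT w (mem_of_mem_erase hw), if_neg (ne_of_mem_erase hw)]]
      simp [card_erase_of_mem ht, Nat.cast_sub (card_pos.2 ⟨t, ht⟩), mul_comm]
    rw [h1, h2]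

end Matrix.IsHermitian

namespace Matrix.IsHermitian

open Matrix Finset

variable {V : Type*} [Fintype V] [DecidableEq V] {A : Matrix V V ℝ}

/-- If having entry `0` is a transitive relation, its classes outside `D` have a transversal. -/
lemma exists_transversal (hA : A.IsHermitian) (h0 : ∀ v, A v v = 0)
    (htrans : ∀ a c d, A a c = 0 → A a d = 0 → A c d = 0) (D : Finset V)
    (hD' : ∀ u ∈ D, ∀ v ∉ D, A v u = 1)
    (hC : ∀ u ∉ D, ∀ v ∉ D, A u v = 0 ∨ A u v = 2) {x y : V} (hx : x ∉ D) (hy : y ∉ D)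
    (hxy : A x y ≠ 0) :
    ∃ T : Finset V, Disjoint D T ∧ 2 ≤ #T ∧
      ∀ v ∉ D, ∃ t ∈ T, ∀ w ∈ T, A v w = if w = t then 0 else 2 := by
  have hs : ∀ u v, A u v = A v u := fun u v => by simpa using hA.apply v u
  let r : Setoid V := ⟨fun u v => A u v = 0, h0, fun {u v} h => (hs v u).trans h,
    fun {u v w} h h' => htrans v u w ((hs v u).trans h) h'⟩
  let rep : V → V := fun v => (Quotient.mk r v).out
  have hrep : ∀ v, A v (rep v) = 0 := fun v => r.symm (Quotient.mk_out (s := r) v)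
  have hrr : ∀ {u v}, A u v = 0 → rep u = rep v := fun {u v} h => by
    simp only [rep]
    rw [Quotient.sound (s := r) h]
  have hrD : ∀ v ∉ D, rep v ∉ D := by
    intro v hv h
    have := hD' _ h v hv
    rw [hrep] at this
    norm_num at this
  have hmem : ∀ v ∉ D, rep v ∈ ({t | t ∉ D ∧ rep t = t} : Finset V) := by
    intro v hv
    simp only [mem_filter, mem_univ, true_and]
    exact ⟨hrD v hv, (hrr (hrep v)).symm⟩
  refine ⟨({t | t ∉ D ∧ rep t = t} : Finset V), ?_, ?_, ?_⟩
  · rw [disjoint_left]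
    intro v hv
    simp [hv]
  · have hne : rep x ≠ rep y := by
      intro h
      have h1 : A (rep x) x = 0 := by rw [hs, hrep]
      have h2 : A (rep x) y = 0 := by rw [h, hs, hrep]
      exact hxy (htrans _ _ _ h1 h2)
    rw [← card_pair hne]
    exact card_le_card (by simp [insert_subset_iff, -mem_filter, hmem x hx, hmem y hy])
  · intro v hv
    refine ⟨rep v, hmem v hv, fun w hw => ?_⟩
    simp only [mem_filter, mem_univ, true_and] at hw
    split_ifs with h
    · rw [h, hrep]
    · refine (hC v hv w hw.1).resolve_left fun h' => h ?_
      rw [hrr h', hw.2]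

variable {D T : Finset V}

lemma exists_form_neg_of_card_eq_one (h1 : #D = 1)
    (hD : ∀ u ∈ D, ∀ v, A u v = if u = v then 0 else 1) (hD' : ∀ u ∈ D, ∀ v ∉ D, A v u = 1)
    (hDT : Disjoint D T) (hT2 : 2 ≤ #T)
    (hT : ∀ v ∉ D, ∃ t ∈ T, ∀ w ∈ T, A v w = if w = t then 0 else 2) :
    ∃ x : V → ℝ, (A *ᵥ x) ⬝ᵥ (A *ᵥ x) + 2 * (x ⬝ᵥ A *ᵥ x) < 0 := by
  have hm : (2 : ℝ) ≤ #T := by exact_mod_cast hT2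
  obtain ⟨d, rfl⟩ := card_eq_one.1 h1
  have hdT : d ∉ T := by simpa using hDT
  -- With m = #T, this coefficient makes A x vanish off d: A x = -m e_d, and the form is m² - 4m(m -
  -- 1) < 0 for m ≥ 2.
  refine ⟨fun v => (if v ∈ ({d} : Finset V) then 2 * ((#T : ℝ) - 1) else 0) -
    if v ∈ T then 1 else 0, ?_⟩
  rw [mulVec_sub_indicator {d} T hD hD' hDT hT]
  simp [dotProduct, hdT]
  nlinarith

lemma exists_form_neg_of_card_eq_two {d e : V} (hde : d ≠ e) (hDe : D = {d, e})
    (hD : ∀ u ∈ D, ∀ v, A u v = if u = v then 0 else 1) (hD' : ∀ u ∈ D, ∀ v ∉ D, A v u = 1)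
    (hDT : Disjoint D T) (hT2 : 2 ≤ #T)
    (hT : ∀ v ∉ D, ∃ t ∈ T, ∀ w ∈ T, A v w = if w = t then 0 else 2) :
    ∃ x : V → ℝ, x d = x e ∧ A *ᵥ x = -(Pi.single d 1 + Pi.single e 1) ∧
      (A *ᵥ x) ⬝ᵥ (A *ᵥ x) + 2 * (x ⬝ᵥ A *ᵥ x) < 0 := by
  have hm : (2 : ℝ) ≤ #T := by exact_mod_cast hT2
  subst hDe
  have hdT : d ∉ T := disjoint_left.1 hDT (by simp)
  have heT : e ∉ T := disjoint_left.1 hDT (by simp)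
  -- Again the coefficient is chosen to make A x vanish off D.
  have hAx : A *ᵥ (fun v => (if v ∈ ({d, e} : Finset V) then (#T : ℝ) - 1 else 0) -
      if v ∈ T then 1 else 0) = -(Pi.single d 1 + Pi.single e 1) := by
    rw [mulVec_sub_indicator {d, e} T hD hD' hDT hT, card_pair hde]
    ext v
    by_cases h1 : v = d
    · subst h1
      simp [hde]
      ring
    by_cases h2 : v = e
    · subst h2
      simp [hde.symm]
      ring
    simp [h1, h2]
    ring
  refine ⟨_, ?_, hAx, ?_⟩
  · simp [hdT, heT]
  · rw [hAx]
    simp [hde, hde.symm, hdT, heT]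
    linarith

end Matrix.IsHermitian

namespace SimpleGraph

open Matrix Finset

variable {V : Type*} {G : SimpleGraph V}

lemma antiAdjMatrix_eq_zero_or_two (hG : G.Connected) (hd : ∀ u v, G.dist u v ≤ 2) {u v : V}
    (hu : ¬ G.IsUniversal u) (hv : ¬ G.IsUniversal v) :
    G.antiAdjMatrix u v = 0 ∨ G.antiAdjMatrix u v = 2 := by
  by_cases h : u = v
  · exact Or.inl (h ▸ antiAdjMatrix_self u)
  by_cases h' : G.Adj u v
  · exact Or.inl (antiAdjMatrix_of_adj hG hu hv h')
  · exact Or.inr (antiAdjMatrix_of_not_adj hG hd h h')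

lemma exists_antiAdjMatrix_eq_two (hG : G.Connected) (hd : ∀ u v, G.dist u v ≤ 2) {u : V}
    (hu : ¬ G.IsUniversal u) : ∃ v, ¬ G.IsUniversal v ∧ G.antiAdjMatrix u v = 2 := by
  unfold IsUniversal at hu
  push Not at hu
  obtain ⟨v, hne, hv⟩ := hu
  exact ⟨v, fun h => hv (h hne.symm).symm, antiAdjMatrix_of_not_adj hG hd hne hv⟩

/-- The column of a universal vertex d is the all-one vector minus e_d, so the all-one parts cancel.
-/
lemma mulVec_single_sub_single_of_isUniversal [Fintype V] [DecidableEq V] (hG : G.Connected)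
    {d e : V} (hd : G.IsUniversal d) (he : G.IsUniversal e) :
    G.antiAdjMatrix *ᵥ (Pi.single d 1 - Pi.single e 1) =
      -(Pi.single d 1 - Pi.single e 1 : V → ℝ) := by
  ext v
  have h : ∀ {d}, G.IsUniversal d → G.antiAdjMatrix v d = 1 - (Pi.single d 1 : V → ℝ) v := by
    intro d hd
    by_cases hv : v = d
    · simp [hv, antiAdjMatrix_self]
    · simp [hv, antiAdjMatrix_comm v d, antiAdjMatrix_of_isUniversal hG hd (Ne.symm hv)]
  simp only [mulVec_sub, mulVec_single_one, Pi.sub_apply, Pi.neg_apply, col_apply]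
  rw [h hd, h he]
  ring

end SimpleGraph

namespace Matrix.IsHermitian

open Matrix Finset

variable {V : Type*} [Fintype V] [DecidableEq V] {A : Matrix V V ℝ}

lemma mulVec_indicator_of_clique {d : V} {S T : Finset V} (hdS : d ∉ S) (hdT : d ∉ T)
    (hST : Disjoint S T)
    (hcov : ∀ v, v = d ∨ v ∈ S ∨ v ∈ T) (hd : ∀ v ∈ S, A d v = 1)
    (hS : ∀ v ∈ S, ∀ w ∈ S, A v w = if v = w then 0 else 2)
    (hTS : ∀ v ∈ T, ∀ w ∈ S, A v w = 0) :
    A *ᵥ (fun v => if v ∈ S then 1 else 0) =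
      (#S : ℝ) • Pi.single d 1 + (2 * ((#S : ℝ) - 1)) • fun v => if v ∈ S then (1 : ℝ) else 0 := by
  ext v
  have h : (A *ᵥ (fun v => if v ∈ S then 1 else 0)) v = ∑ w ∈ S, A v w := by
    simp [mulVec, dotProduct]
  rw [h]
  rcases hcov v with rfl | hv | hv
  · rw [Finset.sum_congr rfl hd]
    simp [hdS]
  · have hne : v ≠ d := fun h => hdS (h ▸ hv)
    rw [← Finset.add_sum_erase S _ hv, hS v hv v hv, if_pos rfl, zero_add,
      Finset.sum_congr rfl fun w hw => (hS v hv w (mem_of_mem_erase hw)).trans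
        (if_neg (ne_of_mem_erase hw).symm)]
    simp [card_erase_of_mem hv, Nat.cast_sub (card_pos.2 ⟨v, hv⟩), hne, hv, mul_comm]
  · have hvS : v ∉ S := fun h => disjoint_left.1 hST h hv
    rw [Finset.sum_congr rfl (hTS v hv)]
    have hne : v ≠ d := fun h => hdT (h ▸ hv)
    simp [hvS, hne]

/-- The span of e_d, 1_S and 1_T is invariant under A, so a vector with negative form can be sought
in it. -/
lemma exists_form_neg_of_two_cliques {d : V} {S T : Finset V} (hdS : d ∉ S) (hdT : d ∉ T)
    (hST : Disjoint S T) (hcov : ∀ v, v = d ∨ v ∈ S ∨ v ∈ T)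
    (hd : ∀ v, A v d = if v = d then 0 else 1) (hd' : ∀ v, A d v = if v = d then 0 else 1)
    (hS : ∀ v ∈ S, ∀ w ∈ S, A v w = if v = w then 0 else 2)
    (hT : ∀ v ∈ T, ∀ w ∈ T, A v w = if v = w then 0 else 2)
    (hTS : ∀ v ∈ T, ∀ w ∈ S, A v w = 0) (hST' : ∀ v ∈ S, ∀ w ∈ T, A v w = 0)
    (hs2 : 2 ≤ #S) (ht2 : 2 ≤ #T) :
    ∃ x : V → ℝ, (A *ᵥ x) ⬝ᵥ (A *ᵥ x) + 2 * (x ⬝ᵥ A *ᵥ x) < 0 := by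
  have hs : (2 : ℝ) ≤ #S := by exact_mod_cast hs2
  have ht : (2 : ℝ) ≤ #T := by exact_mod_cast ht2
  set s : ℝ := (#S : ℝ)
  set t : ℝ := (#T : ℝ)
  let e : V → ℝ := Pi.single d 1
  let iS : V → ℝ := fun v => if v ∈ S then 1 else 0
  let iT : V → ℝ := fun v => if v ∈ T then 1 else 0
  have hAe : A *ᵥ e = iS + iT := by
    ext v
    simp only [e, iS, iT, mulVec_single_one, col_apply, hd, Pi.add_apply]
    rcases hcov v with rfl | hv | hv
    · simp [hdS, hdT]
    · have h1 : v ≠ d := fun h => hdS (h ▸ hv)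
      simp [h1, hv, disjoint_left.1 hST hv]
    · have h1 : v ≠ d := fun h => hdT (h ▸ hv)
      simp [h1, hv, disjoint_right.1 hST hv]
  have hAS : A *ᵥ iS = s • e + (2 * (s - 1)) • iS :=
    mulVec_indicator_of_clique hdS hdT hST hcov
      (fun v hv => by rw [hd', if_neg (fun h : v = d => hdS (h ▸ hv))]) hS hTS
  have hAT : A *ᵥ iT = t • e + (2 * (t - 1)) • iT :=
    mulVec_indicator_of_clique hdT hdS hST.symm (fun v => (hcov v).imp_right Or.symm)
      (fun v hv => by rw [hd', if_neg (fun h : v = d => hdT (h ▸ hv))]) hT hST'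
  have hee : e ⬝ᵥ e = 1 := by simp [e]
  have heS : e ⬝ᵥ iS = 0 := by simp [e, iS, hdS]
  have heT : e ⬝ᵥ iT = 0 := by simp [e, iT, hdT]
  have hSS : iS ⬝ᵥ iS = s := by simp [iS, s, dotProduct]
  have hTT : iT ⬝ᵥ iT = t := by simp [iT, t, dotProduct]
  have hSiT : iS ⬝ᵥ iT = 0 := by
    simp [iS, iT, dotProduct, disjoint_iff_inter_eq_empty.1 hST.symm]
  have hs1 : s - 1 ≠ 0 := by linarith
  have ht1 : t - 1 ≠ 0 := by linarith
  have hst : 0 < s + t := by linarith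
  -- For x = (2 + δ) e - α 1_S - β 1_T, these α and β leave A x equal to δ on S and T. With c = αs +
  -- βt = 2 + α + β in (2, 4], taking δ = 0 would give c(c - 4), which vanishes at s = t = 2; a
  -- positive δ adds -4cδ + δ²(s + t), here -4cδ + δ < 0.
  obtain ⟨δ, hδ⟩ : ∃ δ, δ = (s + t)⁻¹ := ⟨_, rfl⟩
  obtain ⟨α, hα⟩ : ∃ α, α = (s - 1)⁻¹ := ⟨_, rfl⟩
  obtain ⟨β, hβ⟩ : ∃ β, β = (t - 1)⁻¹ := ⟨_, rfl⟩
  have hα' : α * (s - 1) = 1 := by rw [hα, inv_mul_cancel₀ hs1]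
  have hβ' : β * (t - 1) = 1 := by rw [hβ, inv_mul_cancel₀ ht1]
  have hδ' : δ * (s + t) = 1 := by rw [hδ, inv_mul_cancel₀ hst.ne']
  have hAx : A *ᵥ ((2 + δ) • e - α • iS - β • iT) =
      -(α * s + β * t) • e + δ • iS + δ • iT := by
    have h1 : (2 : ℝ) + δ - 2 = δ := by ring
    have h2 : ∀ u : V → ℝ, α • (2 * (s - 1)) • u = (2 : ℝ) • u := fun u => by
      rw [smul_smul]
      congr 1
      linear_combination 2 * hα'
    have h3 : ∀ u : V → ℝ, β • (2 * (t - 1)) • u = (2 : ℝ) • u := fun u => by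
      rw [smul_smul]
      congr 1
      linear_combination 2 * hβ'
    rw [mulVec_sub, mulVec_sub, mulVec_smul, mulVec_smul, mulVec_smul, hAe, hAS, hAT, smul_add α,
      smul_add β, h2, h3]
    module
  refine ⟨(2 + δ) • e - α • iS - β • iT, ?_⟩
  rw [hAx]
  simp only [dotProduct_add, add_dotProduct, sub_dotProduct, dotProduct_smul, smul_dotProduct,
    smul_eq_mul, hee, heS, heT, hSS, hTT, hSiT, dotProduct_comm iS e, dotProduct_comm iT e,
    dotProduct_comm iT iS]
  have hα1 : α * s = 1 + α := by linear_combination hα'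
  have hβ1 : β * t = 1 + β := by linear_combination hβ'
  have hα0 : 0 < α := by rw [hα, inv_pos]; linarith
  have hβ0 : 0 < β := by rw [hβ, inv_pos]; linarith
  have hα2 : α ≤ 1 := by rw [hα]; exact inv_le_one_of_one_le₀ (by linarith)
  have hβ2 : β ≤ 1 := by rw [hβ]; exact inv_le_one_of_one_le₀ (by linarith)
  have hδ0 : 0 < δ := by rw [hδ, inv_pos]; exact hst
  obtain ⟨c, hc⟩ : ∃ c, c = α * s + β * t := ⟨_, rfl⟩
  have hc2 : 2 < c := by linarith
  have hc4 : c ≤ 4 := by linarith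
  have : c * (c - 4) - 4 * c * δ + δ < 0 := by nlinarith [mul_pos hδ0 (by linarith : 0 < c)]
  rw [← hc]
  have e1 : δ * s + δ * t = 1 := by linarith
  calc _ = c * (c - 4) - 4 * c * δ + δ * (δ * s + δ * t) := by
        rw [hc]; ring
    _ < 0 := by rw [e1]; linarith

end Matrix.IsHermitian

/-! ### Graphs with a universal vertex -/

namespace SimpleGraph

open Matrix Finset

variable {V : Type*} {G : SimpleGraph V}

lemma isCompleteBipartite_of_star [Nontrivial V] {d : V} (hd : G.IsUniversal d)
    (h : ∀ u v, u ≠ d → v ≠ d → ¬ G.Adj u v) : G.IsCompleteBipartite := by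
  classical
  obtain ⟨v, hv⟩ := exists_ne d
  refine ⟨fun x => if x = d then 0 else 1, ?_, ?_⟩
  · intro i
    fin_cases i
    · exact ⟨d, by simp⟩
    · exact ⟨v, by simp [hv]⟩
  · intro x y
    by_cases hx : x = d <;> by_cases hy : y = d
    · simp [hx, hy]
    · simpa [hx, hy] using hd (Ne.symm hy)
    · simpa [hx, hy] using (hd (Ne.symm hx)).symm
    · simpa [hx, hy] using h x y hx hy

variable [Fintype V] [DecidableEq V]

lemma isCompleteBipartite_of_isUniversal [Nontrivial V] (hG : G.Connected)
    (hn : G.numAntiAdjEigenvaluesNe ≤ 2) {d : V} (hd : G.IsUniversal d) :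
    G.IsCompleteBipartite := by
  classical
  have hA := G.antiAdjMatrix_isHermitian
  have h0 := G.antiAdjMatrix_self
  have hnn := G.antiAdjMatrix_nonneg
  have hs := G.antiAdjMatrix_comm
  have hdist := dist_le_two_of_isUniversal hd
  have hrow := exists_antiAdjMatrix_pos hG
  have htrans : #{i | 0 < hA.eigenvalues i} ≤ 1 → ∀ a c d, G.antiAdjMatrix a c = 0 →
      G.antiAdjMatrix a d = 0 → G.antiAdjMatrix c d = 0 :=
    fun hp a c d => hA.apply_eq_zero_trans h0 hnn hrow hp
  have hp1 : 1 ≤ #{i | 0 < hA.eigenvalues i} := by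
    obtain ⟨v, hv⟩ := hrow d
    exact hA.one_le_card_pos h0 hv
  rw [numAntiAdjEigenvaluesNe_eq] at hn
  have hcases : ∀ {u v}, ¬ G.IsUniversal u → ¬ G.IsUniversal v →
      G.antiAdjMatrix u v = 0 ∨ G.antiAdjMatrix u v = 2 :=
    fun hu hv => antiAdjMatrix_eq_zero_or_two hG hdist hu hv
  have htwo : ∀ {u}, ¬ G.IsUniversal u → ∃ v, ¬ G.IsUniversal v ∧ G.antiAdjMatrix u v = 2 :=
    fun hu => exists_antiAdjMatrix_eq_two hG hdist hu
  let D : Finset V := {u | G.IsUniversal u}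
  have hmD : ∀ {u}, u ∈ D ↔ G.IsUniversal u := by simp [D]
  have hD : ∀ u ∈ D, ∀ v, G.antiAdjMatrix u v = if u = v then 0 else 1 := by
    intro u hu v
    split_ifs with h
    · rw [h, h0]
    · exact antiAdjMatrix_of_isUniversal hG (hmD.1 hu) h
  have hD' : ∀ u ∈ D, ∀ v ∉ D, G.antiAdjMatrix v u = 1 := by
    intro u hu v hv
    rw [hs, hD u hu, if_neg (fun h : u = v => hv (h ▸ hu))]
  have hC : ∀ u ∉ D, ∀ v ∉ D, G.antiAdjMatrix u v = 0 ∨ G.antiAdjMatrix u v = 2 :=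
    fun u hu v hv => hcases (mt hmD.2 hu) (mt hmD.2 hv)
  have hT : ∀ {u}, ¬ G.IsUniversal u → #{i | 0 < hA.eigenvalues i} ≤ 1 →
      ∃ T : Finset V, Disjoint D T ∧ 2 ≤ #T ∧
      ∀ v ∉ D, ∃ t ∈ T, ∀ w ∈ T, G.antiAdjMatrix v w = if w = t then 0 else 2 := by
    intro u hu hp
    obtain ⟨v, hv, huv⟩ := htwo hu
    exact hA.exists_transversal h0 (htrans hp) D hD' hC (mt hmD.1 hu) (mt hmD.1 hv)
      (by rw [huv]; norm_num)
  have hq : ∀ x : V → ℝ, (G.antiAdjMatrix *ᵥ x) ⬝ᵥ (G.antiAdjMatrix *ᵥ x) +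
      2 * (x ⬝ᵥ G.antiAdjMatrix *ᵥ x) < 0 →
      1 ≤ #{i | -2 < hA.eigenvalues i ∧ hA.eigenvalues i < 0} := by
    intro x hx
    exact hA.le_card_Ioo ![x] (fun i j hij => absurd (Subsingleton.elim i j) hij)
      (fun i => by fin_cases i; exact hx)
  by_cases hk1 : ∃ e, e ≠ d ∧ G.IsUniversal e
  · obtain ⟨e, hed, he⟩ := hk1
    have hy := mulVec_single_sub_single_of_isUniversal hG hd he
    by_cases hk2 : ∃ f, f ≠ d ∧ f ≠ e ∧ G.IsUniversal f
    · exfalso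
      obtain ⟨f, hfd, hfe, hf⟩ := hk2
      have hy1 := mulVec_single_sub_single_of_isUniversal hG hd hf
      have hy2 := mulVec_single_sub_single_of_isUniversal hG he hf
      -- Orthogonal eigenvectors e_d - e_e and e_d + e_e - 2e_f for -1: q ≥ 2, and p ≥ 1 already.
      have := hA.le_card_Ioo_of_mulVec_eq_neg ![Pi.single d 1 - Pi.single e 1,
        (Pi.single d 1 - Pi.single f 1) + (Pi.single e 1 - Pi.single f 1)] ?_ ?_ ?_
      · omega
      · intro i
        fin_cases i
        · exact hy
        · simp only [Fin.mk_one, cons_val_one, cons_val_fin_one]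
          rw [mulVec_add, hy1, hy2, neg_add]
      · intro i j hij
        fin_cases i <;> fin_cases j <;> first | exact absurd rfl hij | skip
        all_goals simp [hed, hed.symm, hfd, hfd.symm, hfe, hfe.symm]
      · intro i h
        fin_cases i
        · have := congrFun h d
          simp [hed.symm] at this
        · have := congrFun h d
          simp [hed.symm, hfd.symm] at this
    · push Not at hk2
      by_cases hall : ∀ u, G.IsUniversal u
      · refine isCompleteBipartite_of_star hd fun u v hu hv h => ?_
        have h1 : u = e := by_contra fun h => hk2 u hu h (hall u)
        have h2 : v = e := by_contra fun h => hk2 v hv h (hall v)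
        exact h.ne (h1.trans h2.symm)
      · exfalso
        push Not at hall
        obtain ⟨u, hu⟩ := hall
        have hyq := hA.le_card_Ioo_of_mulVec_eq_neg ![Pi.single d 1 - Pi.single e 1]
          (fun i => by fin_cases i; exact hy) (fun i j hij => absurd (Subsingleton.elim i j) hij)
          (fun i h => by
            fin_cases i
            have := congrFun h d
            simp [hed.symm] at this)
        obtain ⟨T, hDT, hT2, hT⟩ := hT hu (by omega)
        have hDe : D = {d, e} := by
          ext v
          simp only [hmD, mem_insert, mem_singleton]
          constructor
          · intro hv
            by_contra! h
            exact hk2 v h.1 h.2 hv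
          · rintro (rfl | rfl) <;> assumption
        obtain ⟨x, hxde, hAx, hx⟩ :=
          IsHermitian.exists_form_neg_of_card_eq_two hed.symm hDe hD hD' hDT hT2 hT
        -- The second vector is symmetric in d and e, hence orthogonal for the form to the
        -- antisymmetric first one: q ≥ 2.
        have := hA.le_card_Ioo ![Pi.single d 1 - Pi.single e 1, x] ?_ ?_
        · omega
        · intro i j hij
          fin_cases i <;> fin_cases j <;> first | exact absurd rfl hij | skip
          · simp only [Fin.zero_eta, Fin.mk_one, cons_val_zero, cons_val_one, cons_val_fin_one]
            rw [hy, hAx]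
            simp [hed, hed.symm]
          · simp only [Fin.zero_eta, Fin.mk_one, cons_val_zero, cons_val_one, cons_val_fin_one]
            rw [hy, hAx]
            simp [hed, hed.symm, hxde]
        · intro i
          fin_cases i
          · simp only [Fin.zero_eta, cons_val_zero]
            rw [hy]
            simp [hed, hed.symm]
            norm_num
          · exact hx
  · push Not at hk1
    have hDd : D = {d} := by
      ext v
      simp only [hmD, mem_singleton]
      exact ⟨fun hv => by_contra fun h => hk1 v h hv, fun h => h ▸ hd⟩
    refine isCompleteBipartite_of_star hd fun u v hu hv huv => ?_
    have hne := huv.ne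
    have huv0 := antiAdjMatrix_of_adj hG (hk1 u hu) (hk1 v hv) huv
    obtain ⟨u', hu', huu'⟩ := htwo (hk1 u hu)
    obtain ⟨v', hv', hvv'⟩ := htwo (hk1 v hv)
    -- If p = 1, a transversal gives q ≥ 1 and the path u, u', v of entries 2 gives r ≥ 1. If p ≥ 2,
    -- then q = r = 0, and r = 0 makes `R` below transitive off d.
    by_cases hp : #{i | 0 < hA.eigenvalues i} ≤ 1
    · obtain ⟨T, hDT, hT2, hT⟩ := hT (hk1 u hu) hp
      obtain ⟨x, hx⟩ := IsHermitian.exists_form_neg_of_card_eq_one (by rw [hDd]; simp) hD hD' hDT hT2 hT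
      have h1 := hq x hx
      have h2 : G.antiAdjMatrix v u' = 2 := by
        refine (hcases (hk1 v hv) hu').resolve_left fun h => ?_
        rw [htrans hp v u u' (by rw [hs, huv0]) h] at huu'
        norm_num at huu'
      have := hA.one_le_card_lt_neg_two_of_path h0 (by rw [hs, huu']) (by rw [hs, h2]) huv0 hne
      omega
    · have hr : ¬ 1 ≤ #{i | hA.eigenvalues i < -2} := by omega
      have hP3 : ∀ {x y z}, x ≠ z → ¬ G.IsUniversal x → ¬ G.IsUniversal z →
          G.antiAdjMatrix x y = 2 → G.antiAdjMatrix y z = 2 → G.antiAdjMatrix x z = 2 := by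
        intro x y z hxz hx hz h1 h2
        refine (hcases hx hz).resolve_left fun h => hr ?_
        exact hA.one_le_card_lt_neg_two_of_path h0 (by rw [hs, h1]) h2 h hxz
      let R : V → V → Prop := fun x y => x = y ∨ G.antiAdjMatrix x y = 2
      have hRs : ∀ {x y}, R x y → R y x := fun h => h.imp Eq.symm fun h => by rw [hs, h]
      have hRt : ∀ {x y z}, x ≠ d → z ≠ d → R x y → R y z → R x z := by
        rintro x y z hx hz (rfl | h1) (rfl | h2)
        · exact Or.inl rfl
        · exact Or.inr h2
        · exact Or.inr h1
        · by_cases hxz : x = z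
          · exact Or.inl hxz
          · exact Or.inr (hP3 hxz (hk1 x hx) (hk1 z hz) h1 h2)
      have hnR : ∀ {x y}, x ≠ d → y ≠ d → ¬ R x y → G.antiAdjMatrix x y = 0 := by
        intro x y hx hy h
        exact (hcases (hk1 x hx) (hk1 y hy)).resolve_right fun h' => h (Or.inr h')
      have huvR : ¬ R u v := by
        rintro (h | h)
        · exact hne h
        · rw [huv0] at h
          norm_num at h
      -- A third class would give three unlinked pairs, so p ≥ 3. Hence the classes of u and v cover
      -- everything but d.
      have hcov : ∀ w, w ≠ d → R u w ∨ R v w := by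
        intro w hw
        by_contra! hcon
        choose f hf hf' using fun x : {x // x ≠ d} => htwo (hk1 x.1 x.2)
        have hfd : ∀ x, f x ≠ d := fun x h => hf x (h ▸ hd)
        let g : Fin 3 → {x // x ≠ d} := ![⟨u, hu⟩, ⟨v, hv⟩, ⟨w, hw⟩]
        have key : ∀ i j, i ≠ j → ¬ R (g i) (g j) := by
          intro i j hij
          fin_cases i <;> fin_cases j <;> first | exact absurd rfl hij | skip
          · exact huvR
          · exact hcon.1
          · exact fun h => huvR (hRs h)
          · exact hcon.2
          · exact fun h => hcon.1 (hRs h)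
          · exact fun h => hcon.2 (hRs h)
        have hgf : ∀ i, R (g i) (f (g i)) := fun i => Or.inr (hf' _)
        have := hA.three_le_card_pos h0 (fun i => g i) (fun i => f (g i))
          (fun i => by rw [hf']; norm_num)
          (fun i j hij => hnR (g i).2 (g j).2 (key i j hij))
          (fun i j hij => hnR (hfd _) (hfd _) fun h => key i j hij
            (hRt (g i).2 (g j).2 (hRt (g i).2 (hfd _) (hgf i) h) (hRs (hgf j))))
          (fun i j hij => hnR (g i).2 (hfd _) fun h => key i j hij
            (hRt (g i).2 (g j).2 h (hRs (hgf j))))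
        omega
      have hclique : ∀ {a x y}, a ≠ d → x ≠ d → y ≠ d → R a x → R a y →
          G.antiAdjMatrix x y = if x = y then 0 else 2 := by
        intro a x y _ hx hy hax hay
        split_ifs with h
        · rw [h, h0]
        · exact (hRt hx hy (hRs hax) hay).resolve_left h
      have hcross : ∀ {x y}, x ≠ d → y ≠ d → R u x → R v y → G.antiAdjMatrix x y = 0 :=
        fun hx hy hux hvy => hnR hx hy fun h =>
          huvR (hRt hu hv hux (hRt hx hv h (hRs hvy)))
      have hud : u' ≠ d := fun h => hu' (h ▸ hd)
      have hvd : v' ≠ d := fun h => hv' (h ▸ hd)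
      have hcard : ∀ {a a'}, a ≠ d → a' ≠ d → G.antiAdjMatrix a a' = 2 →
          2 ≤ #{w | w ≠ d ∧ R a w} := by
        intro a a' ha ha' haa
        have hne : a ≠ a' := by
          rintro rfl
          rw [h0] at haa
          norm_num at haa
        rw [← card_pair hne]
        refine card_le_card fun w hw => ?_
        simp only [mem_insert, mem_singleton] at hw
        simp only [mem_filter, mem_univ, true_and]
        rcases hw with rfl | rfl
        · exact ⟨ha, Or.inl rfl⟩
        · exact ⟨ha', Or.inr haa⟩
      have hdd : d ∈ D := hmD.2 hd
      obtain ⟨x, hx⟩ := IsHermitian.exists_form_neg_of_two_cliques (A := G.antiAdjMatrix) (d := d)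
        (S := ({w | w ≠ d ∧ R u w} : Finset V)) (T := ({w | w ≠ d ∧ R v w} : Finset V))
        (by simp) (by simp)
        (by
          rw [Finset.disjoint_left]
          intro w hw hw'
          simp only [mem_filter, mem_univ, true_and] at hw hw'
          exact huvR (hRt hu hv hw.2 (hRs hw'.2)))
        (by
          intro w
          simp only [mem_filter, mem_univ, true_and]
          by_cases hw : w = d
          · exact Or.inl hw
          · exact Or.inr ((hcov w hw).imp (fun h => ⟨hw, h⟩) fun h => ⟨hw, h⟩))
        (by
          intro w
          rw [hs, hD d hdd]
          simp only [eq_comm])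
        (by
          intro w
          rw [hD d hdd]
          simp only [eq_comm])
        (by
          intro x hx y hy
          simp only [mem_filter, mem_univ, true_and] at hx hy
          exact hclique hu hx.1 hy.1 hx.2 hy.2)
        (by
          intro x hx y hy
          simp only [mem_filter, mem_univ, true_and] at hx hy
          exact hclique hv hx.1 hy.1 hx.2 hy.2)
        (by
          intro x hx y hy
          simp only [mem_filter, mem_univ, true_and] at hx hy
          rw [hs]
          exact hcross hy.1 hx.1 hy.2 hx.2)
        (by
          intro x hx y hy
          simp only [mem_filter, mem_univ, true_and] at hx hy
          exact hcross hx.1 hy.1 hx.2 hy.2)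
        (hcard hu hud huu') (hcard hv hvd hvv')
      have := hq x hx
      omega

end SimpleGraph

/-! ### Complete bipartite graphs: presentations and spectrum -/

namespace SimpleGraph

open Matrix Finset

variable {V W : Type*} {G : SimpleGraph V} {H : SimpleGraph W}

/-- Adjacency depends only on colours, so gluing bijections of the colour classes gives an
isomorphism. -/
lemma nonempty_iso_of_card_fiber_eq [Finite V] [Finite W] {c : V → Fin 2} {c' : W → Fin 2}
    (hc : ∀ u v, G.Adj u v ↔ c u ≠ c v) (hc' : ∀ u v, H.Adj u v ↔ c' u ≠ c' v)
    (h : ∀ i, Nat.card {v // c v = i} = Nat.card {w // c' w = i}) : Nonempty (G ≃g H) := by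
  have h' : ∀ i, Nonempty ({v // c v = i} ≃ {w // c' w = i}) := fun i => Finite.card_eq.1 (h i)
  let e : V ≃ W := (Equiv.sigmaFiberEquiv c).symm.trans
    ((Equiv.sigmaCongrRight fun i => (h' i).some).trans (Equiv.sigmaFiberEquiv c'))
  have he : ∀ v, c' (e v) = c v := fun v => ((h' (c v)).some ⟨v, rfl⟩).2
  exact ⟨e, fun {u v} => by rw [hc, hc', he, he]⟩

lemma IsCompleteBipartite.of_iso (h : H.IsCompleteBipartite) (e : G ≃g H) :
    G.IsCompleteBipartite := by
  obtain ⟨c, hsurj, hc⟩ := h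
  exact ⟨c ∘ e, hsurj.comp e.surjective, fun u v => by rw [← e.map_adj_iff, hc]; rfl⟩

lemma mixedExtension_top_adj (t₀ t₁ : ℕ)
    (x y : Σ i, Fin ((![-(t₀ : ℤ), -(t₁ : ℤ)] : Fin 2 → ℤ) i).natAbs) :
    ((⊤ : SimpleGraph (Fin 2)).mixedExtension ![-(t₀ : ℤ), -(t₁ : ℤ)]).Adj x y ↔ x.1 ≠ y.1 := by
  have h : ¬ 0 < (![-(t₀ : ℤ), -(t₁ : ℤ)] : Fin 2 → ℤ) x.1 := by
    generalize x.1 = i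
    fin_cases i <;> simp
  simp [mixedExtension, h]

lemma completeBipartiteGraph_adj_iff {α β : Type*} (x y : α ⊕ β) :
    (completeBipartiteGraph α β).Adj x y ↔
      (Sum.elim (fun _ => 0) (fun _ => 1) x : Fin 2) ≠ Sum.elim (fun _ => 0) (fun _ => 1) y := by
  rcases x with x | x <;> rcases y with y | y <;> simp

lemma isCompleteBipartite_iff_mixedExtension [Finite V] : G.IsCompleteBipartite ↔
    ∃ t₀ t₁ : ℕ, 1 ≤ t₀ ∧ 1 ≤ t₁ ∧
      Nonempty (G ≃g (⊤ : SimpleGraph (Fin 2)).mixedExtension ![-(t₀ : ℤ), -(t₁ : ℤ)]) := by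
  constructor
  · rintro ⟨c, hsurj, hc⟩
    have hpos : ∀ i, 1 ≤ Nat.card {v // c v = i} := fun i => by
      obtain ⟨v, hv⟩ := hsurj i
      have : Nonempty {v // c v = i} := ⟨⟨v, hv⟩⟩
      exact Nat.card_pos
    refine ⟨_, _, hpos 0, hpos 1,
      nonempty_iso_of_card_fiber_eq hc (mixedExtension_top_adj _ _) fun i => ?_⟩
    rw [Nat.card_congr (Equiv.sigmaSubtype i)]
    fin_cases i <;> simp
  · rintro ⟨t₀, t₁, h₀, h₁, ⟨e⟩⟩
    refine IsCompleteBipartite.of_iso ⟨Sigma.fst, fun i => ?_, mixedExtension_top_adj _ _⟩ e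
    fin_cases i
    · exact ⟨⟨0, ⟨0, by simp; omega⟩⟩, rfl⟩
    · exact ⟨⟨1, ⟨0, by simp; omega⟩⟩, rfl⟩

lemma isCompleteBipartite_iff_completeBipartiteGraph [Finite V] : G.IsCompleteBipartite ↔
    ∃ t₀ t₁ : ℕ, 1 ≤ t₀ ∧ 1 ≤ t₁ ∧
      Nonempty (G ≃g completeBipartiteGraph (Fin t₀) (Fin t₁)) := by
  constructor
  · rintro ⟨c, hsurj, hc⟩
    have hpos : ∀ i, 1 ≤ Nat.card {v // c v = i} := fun i => by
      obtain ⟨v, hv⟩ := hsurj i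
      have : Nonempty {v // c v = i} := ⟨⟨v, hv⟩⟩
      exact Nat.card_pos
    refine ⟨_, _, hpos 0, hpos 1,
      nonempty_iso_of_card_fiber_eq hc completeBipartiteGraph_adj_iff fun i => ?_⟩
    rw [Nat.card_congr Equiv.subtypeSum, Nat.card_sum]
    fin_cases i <;> simp
  · rintro ⟨t₀, t₁, h₀, h₁, ⟨e⟩⟩
    refine IsCompleteBipartite.of_iso ⟨_, fun i => ?_, completeBipartiteGraph_adj_iff⟩ e
    fin_cases i
    · exact ⟨Sum.inl ⟨0, h₀⟩, rfl⟩
    · exact ⟨Sum.inr ⟨0, h₁⟩, rfl⟩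

variable [Fintype V] [DecidableEq V]

lemma IsCompleteBipartite.numAntiAdjEigenvaluesNe_eq_two (hG : G.Connected)
    (h : G.IsCompleteBipartite) : G.numAntiAdjEigenvaluesNe = 2 := by
  have hA := G.antiAdjMatrix_isHermitian
  have h0 := G.antiAdjMatrix_self
  obtain ⟨c, hsurj, hc⟩ := h
  obtain ⟨a₀, ha₀⟩ := hsurj 0
  obtain ⟨a₁, ha₁⟩ := hsurj 1
  have hd : ∀ u v, G.dist u v ≤ 2 := by
    intro u v
    by_cases huv : c u = c v
    · obtain ⟨w, hw⟩ := hsurj (c u + 1)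
      have h1 : G.Adj u w := by
        rw [hc, hw]
        generalize c u = i
        fin_cases i <;> simp
      have h2 : G.Adj w v := by
        rw [hc, ← huv, ← hc]
        exact h1.symm
      exact dist_le (Walk.cons h1 (Walk.cons h2 Walk.nil))
    · rw [dist_eq_one_iff_adj.2 ((hc u v).2 huv)]
      norm_num
  have hsame : ∀ {u v}, u ≠ v → c u = c v → G.antiAdjMatrix u v = 2 := fun hne huv =>
    antiAdjMatrix_of_not_adj hG hd hne (by rw [hc]; exact fun h => h huv)
  -- A + 2I is 2 within a side and b across, so it factors through `Fin 2`. Here b is 1 if a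
  -- universal vertex exists and 0 otherwise.
  have hle : ∀ b : ℝ, (∀ u v, c u ≠ c v → G.antiAdjMatrix u v = b) →
      G.numAntiAdjEigenvaluesNe ≤ 2 := by
    intro b hb
    refine hA.card_filter_roots_charpoly_le_rank.trans ?_
    have : G.antiAdjMatrix + (2 : ℝ) • 1 =
        (of fun v i => if c v = i then (1 : ℝ) else 0 : Matrix V (Fin 2) ℝ) *
          (of fun i w => if i = c w then 2 else b) := by
      ext u v
      rw [mul_apply]
      simp only [of_apply, ite_mul, one_mul, zero_mul, Finset.sum_ite_eq, mem_univ, if_true]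
      by_cases huv : u = v
      · subst huv
        simp [h0]
      · by_cases hcc : c u = c v
        · simp [huv, hcc, hsame huv hcc]
        · simp [huv, hcc, hb u v hcc]
    rw [this]
    exact (rank_mul_le_left _ _).trans ((rank_le_card_width _).trans (by simp))
  by_cases hu : ∃ d, G.IsUniversal d
  · obtain ⟨d, hu⟩ := hu
    have hcd : ∀ v, v ≠ d → c v ≠ c d := fun v hv => (hc v d).1 (hu hv.symm).symm
    have hne : ∀ u v, c u ≠ c v → G.antiAdjMatrix u v = 1 := by
      intro u v huv
      by_cases h1 : u = d
      · subst h1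
        exact antiAdjMatrix_of_isUniversal hG hu fun h => huv (h ▸ rfl)
      · by_cases h2 : v = d
        · subst h2
          rw [antiAdjMatrix_comm]
          exact antiAdjMatrix_of_isUniversal hG hu fun h => huv (h ▸ rfl)
        · have := hcd u h1
          have := hcd v h2
          omega
    have h2 := hle 1 hne
    have hp : 1 ≤ #{i | 0 < hA.eigenvalues i} :=
      hA.one_le_card_pos h0 (a := a₀) (b := a₁)
        (by rw [hne _ _ (by rw [ha₀, ha₁]; decide)]; exact one_pos)
    obtain ⟨t, ht⟩ : ∃ t, t ∈ univ.erase d := by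
      by_cases h : a₀ = d
      · exact ⟨a₁, by simp; rintro rfl; rw [h, ha₁] at ha₀; norm_num at ha₀⟩
      · exact ⟨a₀, by simp [h]⟩
    have hq : 1 ≤ #{i | -2 < hA.eigenvalues i ∧ hA.eigenvalues i < 0} := by
      -- With m = #T, the coefficient 2m gives the form the value -3m²; the coefficient 2(m - 1)
      -- used earlier would fail for m = 1, that is for K₂.
      have hmul := IsHermitian.mulVec_sub_indicator (A := G.antiAdjMatrix) {d} (univ.erase d)
        (fun u hu' v => by
          obtain rfl := mem_singleton.1 hu'
          split_ifs with h
          · rw [h, h0]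
          · exact antiAdjMatrix_of_isUniversal hG hu h)
        (fun u hu' v hv => by
          obtain rfl := mem_singleton.1 hu'
          rw [antiAdjMatrix_comm]
          exact antiAdjMatrix_of_isUniversal hG hu fun h => hv (by simp [h]))
        (by simp)
        (fun v hv => ⟨v, by simpa using hv, fun w hw => by
          split_ifs with h
          · rw [h, h0]
          · refine hsame (Ne.symm h) ?_
            have h3 := hcd v (by simpa using hv)
            have h4 := hcd w (ne_of_mem_erase hw)
            omega⟩) (2 * #(univ.erase d))
      have hm : (0 : ℝ) < #(univ.erase d) := by
        exact_mod_cast card_pos.2 ⟨_, ht⟩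
      have hdT : d ∉ univ.erase d := notMem_erase d univ
      have hsplit : ∀ f : V → ℝ, ∑ v, f v = f d + ∑ v ∈ univ.erase d, f v := fun f =>
        (Finset.add_sum_erase univ f (mem_univ d)).symm
      have hvd : ∀ v ∈ univ.erase d, v ≠ d := fun v hv => ne_of_mem_erase hv
      generalize univ.erase d = T at hmul hm hdT hsplit hvd
      obtain ⟨x, hx⟩ : ∃ x : V → ℝ, x = fun v =>
        (if v ∈ ({d} : Finset V) then 2 * (#T : ℝ) else 0) - if v ∈ T then 1 else 0 := ⟨_, rfl⟩
      rw [← hx] at hmul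
      have hxd : x d = 2 * #T := by simp [hx, hdT]
      have hxT : ∀ v ∈ T, x v = -1 := fun v hv => by simp [hx, hv, hvd v hv]
      have hAd : (G.antiAdjMatrix *ᵥ x) d = -#T := by simp [hmul]
      have hAT : ∀ v ∈ T, (G.antiAdjMatrix *ᵥ x) v = 2 := fun v hv => by
        simp only [hmul, mem_singleton, hvd v hv, if_false, card_singleton, Nat.cast_one]
        ring
      refine hA.le_card_Ioo ![x] (fun i j hij => absurd (Subsingleton.elim i j) hij) (fun i => ?_)
      fin_cases i
      simp only [Fin.zero_eta, cons_val_fin_one, dotProduct, hsplit, hxd, hAd]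
      have e1 : ∑ v ∈ T, (G.antiAdjMatrix *ᵥ x) v * (G.antiAdjMatrix *ᵥ x) v = #T * (2 * 2) := by
        rw [Finset.sum_congr rfl fun v hv => by rw [hAT v hv], sum_const, nsmul_eq_mul]
      have e2 : ∑ v ∈ T, x v * (G.antiAdjMatrix *ᵥ x) v = #T * (-1 * 2) := by
        rw [Finset.sum_congr rfl fun v hv => by rw [hxT v hv, hAT v hv], sum_const, nsmul_eq_mul]
      rw [e1, e2]
      nlinarith
    rw [numAntiAdjEigenvaluesNe_eq] at h2 ⊢
    omega
  · push Not at hu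
    have hne : ∀ u v, c u ≠ c v → G.antiAdjMatrix u v = 0 := fun u v huv =>
      antiAdjMatrix_of_adj hG (hu u) (hu v) ((hc u v).2 huv)
    have h2 := hle 0 hne
    have hex : ∀ u, ∃ w, c u = c w ∧ 0 < G.antiAdjMatrix u w := by
      intro u
      obtain ⟨w, -, hw⟩ := exists_antiAdjMatrix_eq_two hG hd (hu u)
      refine ⟨w, by_contra fun h => ?_, by rw [hw]; norm_num⟩
      rw [hne u w h] at hw
      norm_num at hw
    obtain ⟨b₀, -, hab₀⟩ := hex a₀
    obtain ⟨b₁, hb₁, hab₁⟩ := hex a₁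
    have := hA.two_le_card_pos h0 hab₀ hab₁ (hne _ _ (by rw [ha₀, ha₁]; decide))
      (hne _ _ (by rw [ha₀, ← hb₁, ha₁]; decide))
    rw [numAntiAdjEigenvaluesNe_eq] at h2 ⊢
    omega

lemma isCompleteBipartite_of_numAntiAdjEigenvaluesNe_le_two [Nontrivial V] (hG : G.Connected)
    (hn : G.numAntiAdjEigenvaluesNe ≤ 2) : G.IsCompleteBipartite := by
  by_cases hu : ∃ d, G.IsUniversal d
  · obtain ⟨d, hd⟩ := hu
    exact isCompleteBipartite_of_isUniversal hG hn hd
  · push Not at hu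
    exact isCompleteBipartite_of_forall_not_isUniversal hG hn hu

lemma numAntiAdjEigenvaluesNe_eq_zero [Subsingleton V] (G : SimpleGraph V) :
    G.numAntiAdjEigenvaluesNe = 0 := by
  have h : G.antiAdjMatrix = 0 := by
    ext u v
    rw [Subsingleton.elim u v, antiAdjMatrix_self, Matrix.zero_apply]
  simp [numAntiAdjEigenvaluesNe, antiAdjSpectrum, h]

end SimpleGraph

theorem theorem1p2 {V : Type*} [Fintype V] [DecidableEq V] (G : SimpleGraph V)
    (hG : G.Connected) :
    G.numAntiAdjEigenvaluesNe ≠ 1 ∧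
    (G.numAntiAdjEigenvaluesNe = 2 ↔
      ∃ t₀ t₁ : ℕ, 1 ≤ t₀ ∧ 1 ≤ t₁ ∧
        Nonempty (G ≃g (⊤ : SimpleGraph (Fin 2)).mixedExtension ![-(t₀ : ℤ), -(t₁ : ℤ)])) ∧
    (G.numAntiAdjEigenvaluesNe = 2 ↔
      ∃ t₀ t₁ : ℕ, 1 ≤ t₀ ∧ 1 ≤ t₁ ∧
        Nonempty (G ≃g completeBipartiteGraph (Fin t₀) (Fin t₁))) := by
  have hiff : G.numAntiAdjEigenvaluesNe = 2 ↔ G.IsCompleteBipartite := by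
    refine ⟨fun h => ?_, fun h => h.numAntiAdjEigenvaluesNe_eq_two hG⟩
    rcases subsingleton_or_nontrivial V with hV | hV
    · rw [SimpleGraph.numAntiAdjEigenvaluesNe_eq_zero] at h
      norm_num at h
    · exact SimpleGraph.isCompleteBipartite_of_numAntiAdjEigenvaluesNe_le_two hG h.le
  refine ⟨fun h => ?_, ?_, ?_⟩
  · rcases subsingleton_or_nontrivial V with hV | hV
    · rw [SimpleGraph.numAntiAdjEigenvaluesNe_eq_zero] at h
      norm_num at h
    -- A count of 1 is at most 2, so G is complete bipartite and the count is 2.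
    · have := hiff.2 (SimpleGraph.isCompleteBipartite_of_numAntiAdjEigenvaluesNe_le_two hG
        (by omega))
      omega
  · rw [hiff, SimpleGraph.isCompleteBipartite_iff_mixedExtension]
  · rw [hiff, SimpleGraph.isCompleteBipartite_iff_completeBipartiteGraph]
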